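/- Let $n\ge 1$, let $S^n\subset\mathbb{R}^{n+1}$ be the unit sphere with the metric induced by the Euclidean inner product, and let $\Delta_{S^n}=-\operatorname{div}\operatorname{grad}$ be its (nonnegative) Laplacian, acting on smooth real functions. Write a point of the tangent bundle $TS^n$ as $(u,v)$ with $u\in S^n$, $v\in\mathbb{R}^{n+1}$ and $u\cdot v=0$. A section of $TS^n\to S^n$ is called a Laplace section if it is the gradient of a smooth function $\chi:S^n\to\mathbb{R}$ with $\Delta_{S^n}\chi=n\chi$ (the function $\chi=0$ is allowed). Then: 1. The map that sends $(u,v)\in TS^n$ to the line $\{v+tu : t\in\mathbb{R}\}$, oriented by $u$, is a bijection from $TS^n$ onto the set of oriented lines in $\mathbb{R}^{n+1}$; here $v$ is the unique point of the line nearest to the origin. 2. For $p\in\mathbb{R}^{n+1}$ let $L_p$ be the section $u\mapsto (u,\ p-(p\cdot u)u)$ of $TS^n\to S^n$. A point of $TS^n$ lies on $L_p$ if and only if the corresponding oriented line passes through $p$. The map $p\mapsto L_p$ is a bijection from $\mathbb{R}^{n+1}$ onto the set of Laplace sections. 3. For every $p\in\mathbb{R}^{n+1}$ the function $\chi(u)=u\cdot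 p$ on $S^n$ satisfies $\Delta_{S^n}\chi=n\chi$ and has gradient $L_p$. Conversely, every smooth function $\chi$ on $S^n$ with $\Delta_{S^n}\chi=n\chi$ is of the form $\chi(u)=u\cdot p$ for a unique $p\in\mathbb{R}^{n+1}$. -/

import Mathlib

open Module Metric
open scoped Manifold ContDiff RealInnerProductSpace

noncomputable section

namespace OrientedLines

/-- Euclidean space `ℝⁿ⁺¹`. -/
abbrev Euc (n : ℕ) : Type := EuclideanSpace ℝ (Fin (n + 1))

/-- The unit sphere `Sⁿ` in `ℝⁿ⁺¹`, with Mathlib's structure of a smooth manifold. -/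
abbrev Sph (n : ℕ) : Type := sphere (0 : Euc n) 1

/-- The tangent space `T_u Sⁿ` of the manifold `Sⁿ`. -/
abbrev TSph (n : ℕ) (u : Sph n) : Type := TangentSpace (𝓡 n) u

instance (n : ℕ) (u : Sph n) : FiniteDimensional ℝ (TSph n u) :=
  inferInstanceAs (FiniteDimensional ℝ (EuclideanSpace ℝ (Fin n)))

/-- The differential at `u` of the inclusion `Sⁿ → ℝⁿ⁺¹`: a tangent vector of the sphere
regarded as a vector of the ambient space. -/
def ambient {n : ℕ} (u : Sph n) : TSph n u →L[ℝ] Euc n :=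
  mvfderiv (𝓡 n) (fun w : Sph n => (w : Euc n)) u

theorem ambient_injective {n : ℕ} (u : Sph n) : Function.Injective (ambient u) := by
  have := Fact.mk (@finrank_euclideanSpace_fin ℝ _ (n + 1))
  exact injective_mvfderiv_subtypeVal_sphere u

/-- The Riemannian metric `h` on `Sⁿ` induced by the Euclidean inner product. -/
def metric {n : ℕ} (u : Sph n) : LinearMap.BilinForm ℝ (TSph n u) :=
  (innerₗ (Euc n)).compl₁₂ (ambient u).toLinearMap (ambient u).toLinearMap

theorem metric_apply {n : ℕ} (u : Sph n) (X Y : TSph n u) :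
    metric u X Y = ⟪ambient u X, ambient u Y⟫ := rfl

theorem metric_nondegenerate {n : ℕ} (u : Sph n) : (metric u).Nondegenerate := by
  constructor
  · intro X hX
    have h := hX X
    rw [metric_apply, inner_self_eq_zero] at h
    exact ambient_injective u (by rw [h, map_zero])
  · intro X hX
    have h := hX X
    rw [metric_apply, inner_self_eq_zero] at h
    exact ambient_injective u (by rw [h, map_zero])

/-- The gradient of a function on `Sⁿ`: the vector field with `h (grad f, X) = df (X)`. -/
def grad {n : ℕ} (f : Sph n → ℝ) (u : Sph n) : TSph n u :=
  (LinearMap.BilinForm.toDual (metric u) (metric_nondegenerate u)).symm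
    (mvfderiv (𝓡 n) f u).toLinearMap

/-- The tangential part of an ambient vector: its orthogonal projection to the image of
`T_u Sⁿ` in `ℝⁿ⁺¹`, regarded as an element of `T_u Sⁿ`. -/
def tangential {n : ℕ} (u : Sph n) : Euc n →ₗ[ℝ] TSph n u :=
  (LinearEquiv.ofInjective (ambient u).toLinearMap (ambient_injective u)).symm.toLinearMap ∘ₗ
    ((LinearMap.range (ambient u).toLinearMap).orthogonalProjectionOnto).toLinearMap

/-- The connection on `Sⁿ` induced by the flat connection of `ℝⁿ⁺¹` (it is the Levi-Civita
connection of the induced metric): `∇_X V` is the tangential part of the derivative in the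
direction `X` of `V`, regarded as an `ℝⁿ⁺¹`-valued function. This is the endomorphism
`X ↦ ∇_X V` of `T_u Sⁿ`. -/
def nabla {n : ℕ} (V : (u : Sph n) → TSph n u) (u : Sph n) : TSph n u →ₗ[ℝ] TSph n u :=
  tangential u ∘ₗ (mvfderiv (𝓡 n) (fun w : Sph n => ambient w (V w)) u).toLinearMap

/-- The divergence of a vector field on `Sⁿ`: the trace of `X ↦ ∇_X V`. -/
def divergence {n : ℕ} (V : (u : Sph n) → TSph n u) (u : Sph n) : ℝ :=
  LinearMap.trace ℝ (TSph n u) (nabla V u)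

/-- The nonnegative Laplacian `-div grad` of the round sphere `Sⁿ`. -/
def laplaceSph {n : ℕ} (f : Sph n → ℝ) (u : Sph n) : ℝ :=
  -divergence (grad f) u

/-- `f` is a smooth function in the eigenspace of the Laplacian of `Sⁿ` for the eigenvalue `c`
(as usual for eigenspaces, `f = 0` is included). -/
def IsEigenfunction {n : ℕ} (c : ℝ) (f : Sph n → ℝ) : Prop :=
  ContMDiff (𝓡 n) 𝓘(ℝ, ℝ) ∞ f ∧ ∀ u, laplaceSph f u = c * f u

/-- The Laplace sections of `TSⁿ → Sⁿ`: gradients of eigenfunctions with eigenvalue `n`. -/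
def IsLaplaceSection {n : ℕ} (s : (u : Sph n) → TSph n u) : Prop :=
  ∃ f : Sph n → ℝ, IsEigenfunction (n : ℝ) f ∧ s = grad f

/-- An oriented line in `ℝⁿ⁺¹`: a line, with the choice of one of the two unit vectors
that span its direction. -/
@[ext]
structure OrientedLine (n : ℕ) where
  line : AffineSubspace ℝ (Euc n)
  dir : Sph n
  nonempty : (line : Set (Euc n)).Nonempty
  direction_eq : line.direction = Submodule.span ℝ {(dir : Euc n)}

/-- The oriented line `{v + t u}` with direction `u` that belongs to the point `(u, v)`
of `TSⁿ`. -/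
def toOrientedLine {n : ℕ} (z : TangentBundle (𝓡 n) (Sph n)) : OrientedLine n where
  line := AffineSubspace.mk' (ambient z.1 z.2) (Submodule.span ℝ {(z.1 : Euc n)})
  dir := z.1
  nonempty := ⟨_, AffineSubspace.self_mem_mk' _ _⟩
  direction_eq := AffineSubspace.direction_mk' _ _

/-- The section `L_p` of `TSⁿ → Sⁿ` that belongs to the point `p` of `ℝⁿ⁺¹`: at `u` it is the
tangential part `p - (p · u) u` of `p`. -/
def pointSection {n : ℕ} (p : Euc n) (u : Sph n) : TSph n u :=
  tangential u p

end OrientedLines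

end

/-! A point `p` lies on the line `v + ℝu` exactly when `p - v` is a multiple of `u`, that is, when
`v` is the tangential part of `p` at `u`. This one equivalence (`tangential_eq_iff`) yields the
correspondence with oriented lines and the incidence statement.

The analytic core is that eigenfunctions for `n` are linear. Extend `f` to `F x = ‖x‖ f (x / ‖x‖)`,
homogeneous of degree one. On the sphere the Laplacian of `f` is `n F - ΔF`
(`laplaceSph_of_homogeneous`), so the eigenvalue equation says that `F` is harmonic off the origin.
Each directional derivative `G` of `F` is then harmonic with zero radial derivative, and integrating
the divergence of `φ G ∇G` with `φ` a radial cut-off forces `∇G = 0` (`fderiv_eq_zero_of_harmonic`).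
Hence `dF` is constant on the connected punctured space, and Euler's identity makes `F` linear. -/

namespace OrientedLines

/-! ### Tangential projection and gradients on the sphere -/

section Sphere

variable {n : ℕ}

instance fact_finrank_euc (n : ℕ) : Fact (finrank ℝ (Euc n) = n + 1) :=
  ⟨finrank_euclideanSpace_fin⟩

theorem norm_coe_sph (u : Sph n) : ‖(u : Euc n)‖ = 1 := by simp

theorem inner_self_sph (u : Sph n) : ⟪(u : Euc n), (u : Euc n)⟫ = 1 := by
  rw [real_inner_self_eq_norm_sq, norm_coe_sph, one_pow]

theorem sph_ne_zero (u : Sph n) : (u : Euc n) ≠ 0 := ne_zero_of_mem_unit_sphere u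

theorem range_ambient (u : Sph n) :
    LinearMap.range (ambient u).toLinearMap = (Submodule.span ℝ {(u : Euc n)})ᗮ :=
  range_mvfderiv_subtypeVal u

theorem inner_ambient (u : Sph n) (X : TSph n u) : ⟪ambient u X, (u : Euc n)⟫ = 0 := by
  have h : ambient u X ∈ (Submodule.span ℝ {(u : Euc n)})ᗮ := by
    rw [← range_ambient]; exact ⟨X, rfl⟩
  rw [real_inner_comm]
  exact Submodule.mem_orthogonal_singleton_iff_inner_right.1 h

theorem tangential_ambient (u : Sph n) (X : TSph n u) : tangential u (ambient u X) = X := by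
  apply (LinearEquiv.ofInjective (ambient u).toLinearMap (ambient_injective u)).injective
  apply Subtype.ext
  simp only [tangential, LinearMap.comp_apply, LinearEquiv.coe_coe, LinearEquiv.apply_symm_apply]
  exact Submodule.starProjection_eq_self_iff.2 ⟨X, rfl⟩

/-- The projection has kernel `(span u)ᗮᗮ = span u`. -/
theorem tangential_eq_iff (u : Sph n) (v : Euc n) (X : TSph n u) :
    tangential u v = X ↔ v - ambient u X ∈ Submodule.span ℝ {(u : Euc n)} := by
  have h : (tangential u v = X) ↔ tangential u (v - ambient u X) = 0 := by
    rw [map_sub, tangential_ambient, sub_eq_zero]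
  rw [h, tangential, LinearMap.comp_apply, LinearEquiv.coe_coe,
    LinearEquiv.map_eq_zero_iff]
  change Submodule.orthogonalProjectionOnto _ _ = 0 ↔ _
  rw [Submodule.orthogonalProjectionOnto_eq_zero_iff, range_ambient,
    Submodule.orthogonal_orthogonal]

theorem ambient_tangential (u : Sph n) (v : Euc n) :
    ambient u (tangential u v) = v - ⟪v, (u : Euc n)⟫ • (u : Euc n) := by
  obtain ⟨c, hc⟩ := Submodule.mem_span_singleton.1 ((tangential_eq_iff u v _).1 rfl)
  have h : c = ⟪v, (u : Euc n)⟫ := by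
    have := congrArg (fun w => ⟪w, (u : Euc n)⟫) hc
    simpa [inner_sub_left, inner_smul_left, inner_self_sph, inner_ambient] using this
  rw [← h, hc, sub_sub_cancel]

theorem tangential_self (u : Sph n) : tangential u (u : Euc n) = 0 := by
  rw [tangential_eq_iff, map_zero, sub_zero]
  exact Submodule.mem_span_singleton_self _

theorem mvfderiv_comp_coe {V : Type*} [NormedAddCommGroup V] [NormedSpace ℝ V] {F : Euc n → V}
    {u : Sph n} (hF : DifferentiableAt ℝ F (u : Euc n)) (X : TSph n u) :
    mvfderiv (𝓡 n) (fun w : Sph n => F w) u X = fderiv ℝ F u (ambient u X) := by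
  have hc : MDifferentiableAt (𝓡 n) 𝓘(ℝ, Euc n) (fun w : Sph n => (w : Euc n)) u :=
    (contMDiff_coe_sphere (m := 1) u).mdifferentiableAt one_ne_zero
  have := mfderiv_comp (I := 𝓡 n) (I' := 𝓘(ℝ, Euc n)) (I'' := 𝓘(ℝ, V)) u
    (g := F) (f := fun w : Sph n => (w : Euc n)) hF.mdifferentiableAt hc
  rw [mfderiv_eq_fderiv] at this
  exact congrArg (fun T => T X) this

theorem metric_grad (f : Sph n → ℝ) (u : Sph n) (X : TSph n u) :
    metric u (grad f u) X = mvfderiv (𝓡 n) f u X :=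
  LinearMap.BilinForm.apply_toDual_symm_apply (hB := metric_nondegenerate u) _ X

theorem grad_comp_coe {F : Euc n → ℝ} {u : Sph n} (hF : DifferentiableAt ℝ F (u : Euc n)) :
    grad (fun w : Sph n => F w) u = tangential u (gradient F u) := by
  have h : ∀ X, metric u (grad (fun w : Sph n => F w) u - tangential u (gradient F u)) X = 0 := by
    intro X
    rw [map_sub, LinearMap.sub_apply, metric_grad, mvfderiv_comp_coe hF, metric_apply,
      ambient_tangential, inner_sub_left, inner_smul_left,
      real_inner_comm (ambient u X) (u : Euc n), inner_ambient, inner_gradient_left]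
    simp
  exact sub_eq_zero.1 ((metric_nondegenerate u).1 _ h)

end Sphere

end OrientedLines

namespace OrientedLines

open MeasureTheory

/-! ### Directional derivatives and homogeneous functions -/

section DirectionalDerivative

variable {E : Type*} [NormedAddCommGroup E] [NormedSpace ℝ E]

/-- The derivative of `f` in the direction `v`, as a function. -/
noncomputable def dirDeriv (v : E) (f : E → ℝ) (x : E) : ℝ := fderiv ℝ f x v

theorem contDiffAt_dirDeriv {f : E → ℝ} {x : E} (hf : ContDiffAt ℝ ∞ f x) (v : E) :
    ContDiffAt ℝ ∞ (dirDeriv v f) x :=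
  (hf.fderiv_right (m := ∞) (by simp)).clm_apply contDiffAt_const

theorem dirDeriv_dirDeriv {f : E → ℝ} {x : E} (hf : ContDiffAt ℝ ∞ f x) (v w : E) :
    dirDeriv w (dirDeriv v f) x = fderiv ℝ (fderiv ℝ f) x w v := by
  have h : DifferentiableAt ℝ (fderiv ℝ f) x :=
    (hf.fderiv_right (m := ∞) (by simp)).differentiableAt (by simp)
  change fderiv ℝ (fun y => fderiv ℝ f y v) x w = _
  rw [fderiv_clm_apply h (differentiableAt_const v)]
  simp

theorem dirDeriv_comm {f : E → ℝ} {x : E} (hf : ContDiffAt ℝ ∞ f x) (v w : E) :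
    dirDeriv w (dirDeriv v f) x = dirDeriv v (dirDeriv w f) x := by
  rw [dirDeriv_dirDeriv hf, dirDeriv_dirDeriv hf]
  exact (hf.isSymmSndFDerivAt (by
    rw [minSmoothness_of_isRCLikeNormedField]
    exact WithTop.coe_le_coe.2 (le_top : (2 : ℕ∞) ≤ ⊤))).eq w v

theorem dirDeriv_congr {f g : E → ℝ} {x : E} (h : f =ᶠ[nhds x] g) (v : E) :
    dirDeriv v f x = dirDeriv v g x := by
  rw [dirDeriv, dirDeriv, h.fderiv_eq]

theorem dirDeriv_mul {f g : E → ℝ} {x : E} (hf : DifferentiableAt ℝ f x)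
    (hg : DifferentiableAt ℝ g x) (v : E) :
    dirDeriv v (fun y => f y * g y) x = f x * dirDeriv v g x + g x * dirDeriv v f x := by
  simp only [dirDeriv]
  rw [fderiv_fun_mul hf hg]
  simp

/-- Differentiate the homogeneity relation in `x`. It is used with `c = t` for `F` and with `c = 1`
for `dF`. -/
theorem fderiv_smul_of_homogeneous {F : Type*} [NormedAddCommGroup F] [NormedSpace ℝ F]
    {f : E → F} {t c : ℝ} (h : ∀ x, f (t • x) = c • f x) (x : E) :
    t • fderiv ℝ f (t • x) = c • fderiv ℝ f x := by
  rw [← fderiv_comp_smul, show (fun y => f (t • y)) = c • f from funext h,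
    fderiv_const_smul_field, Pi.smul_apply]

/-- Euler's identity in degree one. -/
theorem fderiv_self_of_homogeneous_one {f : E → ℝ} (h : ∀ t : ℝ, 0 < t → ∀ x, f (t • x) = t * f x)
    {x : E} (hf : DifferentiableAt ℝ f x) : fderiv ℝ f x x = f x := by
  have h1 : HasDerivAt (fun t : ℝ => f (t • x)) (fderiv ℝ f x x) 1 := by
    have hs : HasDerivAt (fun t : ℝ => t • x) x 1 := by
      simpa using (hasDerivAt_id (1 : ℝ)).smul_const x
    have hf' : HasFDerivAt f (fderiv ℝ f x) ((1 : ℝ) • x) := by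
      rw [one_smul]; exact hf.hasFDerivAt
    exact hf'.comp_hasDerivAt 1 hs
  have h2 : HasDerivAt (fun t : ℝ => f (t • x)) (f x) 1 := by
    have : HasDerivAt (fun t : ℝ => t * f x) (f x) 1 := by
      simpa using (hasDerivAt_id (1 : ℝ)).mul_const (f x)
    refine this.congr_of_eventuallyEq ?_
    filter_upwards [lt_mem_nhds (zero_lt_one' ℝ)] with t ht using h t ht x
  exact h1.unique h2

/-- Euler's identity in degree zero. -/
theorem fderiv_self_of_homogeneous_zero {F : Type*} [NormedAddCommGroup F] [NormedSpace ℝ F]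
    {f : E → F} (h : ∀ t : ℝ, 0 < t → ∀ x, f (t • x) = f x)
    {x : E} (hf : DifferentiableAt ℝ f x) : fderiv ℝ f x x = 0 := by
  have h1 : HasDerivAt (fun t : ℝ => f (t • x)) (fderiv ℝ f x x) 1 := by
    have hs : HasDerivAt (fun t : ℝ => t • x) x 1 := by
      simpa using (hasDerivAt_id (1 : ℝ)).smul_const x
    have hf' : HasFDerivAt f (fderiv ℝ f x) ((1 : ℝ) • x) := by
      rw [one_smul]; exact hf.hasFDerivAt
    exact hf'.comp_hasDerivAt 1 hs
  have h2 : HasDerivAt (fun t : ℝ => f (t • x)) 0 1 := by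
    refine (hasDerivAt_const (1 : ℝ) (f x)).congr_of_eventuallyEq ?_
    filter_upwards [lt_mem_nhds (zero_lt_one' ℝ)] with t ht using h t ht x
  exact h1.unique h2

theorem fderiv_smul_eq_of_homogeneous_one {f : E → ℝ}
    (h : ∀ t : ℝ, 0 < t → ∀ x, f (t • x) = t * f x) (t : ℝ) (ht : 0 < t) (x : E) :
    fderiv ℝ f (t • x) = fderiv ℝ f x :=
  smul_right_injective _ ht.ne' (fderiv_smul_of_homogeneous (h t ht) x)

end DirectionalDerivative

/-! ### Integration by parts and rigidity of homogeneous harmonic functions -/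

section Divergence

variable {E : Type*} [NormedAddCommGroup E] [InnerProductSpace ℝ E] [FiniteDimensional ℝ E]
  [MeasurableSpace E] [BorelSpace E] {ι : Type*} [Fintype ι]

/-- Integration by parts against the constant `1`. -/
theorem integral_dirDeriv_eq_zero {W : E → ℝ} (hW : ContDiff ℝ 1 W) (hc : HasCompactSupport W)
    (v : E) : ∫ x, dirDeriv v W x = 0 := by
  have hint : Integrable (fun x => fderiv ℝ W x v) :=
    ((hW.continuous_fderiv one_ne_zero).clm_apply continuous_const).integrable_of_hasCompactSupport
      (hc.fderiv_apply (𝕜 := ℝ) v)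
  have := integral_mul_fderiv_eq_neg_fderiv_mul_of_integrable (μ := (volume : Measure E))
    (f := fun _ => (1 : ℝ)) (g := W) (v := v) (by simp) (by simpa using hint)
    (by simpa using hW.continuous.integrable_of_hasCompactSupport hc)
    (fun x _ => differentiableAt_const _) (fun x _ => hW.differentiable one_ne_zero x)
  simpa [dirDeriv] using this

/-- A harmonic function on the punctured space with vanishing radial derivative has vanishing
differential: integrate the divergence of `φ G ∇G` for a radial cut-off function `φ`. -/
theorem fderiv_eq_zero_of_harmonic (b : OrthonormalBasis ι ℝ E) {G : E → ℝ}
    (hG : ∀ x ≠ 0, ContDiffAt ℝ ∞ G x) (hrad : ∀ x ≠ 0, fderiv ℝ G x x = 0)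
    (hharm : ∀ x ≠ 0, ∑ i, dirDeriv (b i) (dirDeriv (b i) G) x = 0) {x₀ : E} (hx₀ : x₀ ≠ 0) :
    fderiv ℝ G x₀ = 0 := by
  have hr : 0 < ‖x₀‖ ^ 2 := by positivity
  -- The bump is in the variable `‖x‖ ^ 2`. Any outer radius below `‖x₀‖ ^ 2` keeps the support of
  -- `φ` away from the origin, where `G` is uncontrolled.
  let β : ContDiffBump (‖x₀‖ ^ 2) := ⟨‖x₀‖ ^ 2 / 3, ‖x₀‖ ^ 2 / 2, by positivity, by linarith⟩
  let φ : E → ℝ := fun x => β (‖x‖ ^ 2)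
  have hφ : ContDiff ℝ ∞ φ := β.contDiff.comp (contDiff_norm_sq ℝ)
  have hφ_support : ∀ x, φ x ≠ 0 → ‖x₀‖ ^ 2 / 2 < ‖x‖ ^ 2 ∧ ‖x‖ ^ 2 < 2 * ‖x₀‖ ^ 2 := by
    intro x hx
    have : ‖x‖ ^ 2 ∈ Function.support β := hx
    rw [β.support_eq, Metric.mem_ball, Real.dist_eq, abs_lt] at this
    change -(‖x₀‖ ^ 2 / 2) < _ ∧ _ < ‖x₀‖ ^ 2 / 2 at this
    constructor <;> linarith [this.1, this.2]
  have hφ_zero : φ =ᶠ[nhds 0] 0 := by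
    have hcont : Continuous fun x : E => ‖x‖ ^ 2 := by fun_prop
    filter_upwards [hcont.continuousAt.eventually_lt (x₀ := (0 : E))
      (continuousAt_const (y := ‖x₀‖ ^ 2 / 2)) (by simpa using hr)] with x hx
    by_contra h
    linarith [(hφ_support x h).1]
  have hφ_compact : HasCompactSupport φ := by
    refine HasCompactSupport.intro (isCompact_closedBall (0 : E) (2 * ‖x₀‖)) fun x hx => ?_
    by_contra h
    have h2 := (hφ_support x h).2
    rw [mem_closedBall_zero_iff, not_le] at hx
    nlinarith [norm_nonneg x₀, norm_nonneg x]
  have hφ_deriv : ∀ x v, dirDeriv v φ x = 2 * deriv β (‖x‖ ^ 2) * ⟪x, v⟫ := by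
    intro x v
    have h1 : HasDerivAt β (deriv β (‖x‖ ^ 2)) (‖x‖ ^ 2) :=
      (β.contDiff.differentiable (n := 1) one_ne_zero _).hasDerivAt
    have h2 := h1.comp_hasFDerivAt x (hasStrictFDerivAt_norm_sq x).hasFDerivAt
    change fderiv ℝ (β ∘ fun x => ‖x‖ ^ 2) x v = _
    rw [h2.fderiv]
    simp
    ring
  let W : ι → E → ℝ := fun i x => φ x * (G x * dirDeriv (b i) G x)
  have hW_zero : ∀ i, W i =ᶠ[nhds 0] 0 := fun i => by
    filter_upwards [hφ_zero] with x hx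
    simp [W, hx]
  have hW : ∀ i, ContDiff ℝ 1 (W i) := fun i => by
    rw [contDiff_iff_contDiffAt]
    intro x
    by_cases hx : x = 0
    · subst hx
      exact contDiffAt_const.congr_of_eventuallyEq (hW_zero i)
    · exact ((hφ.contDiffAt.mul ((hG x hx).mul (contDiffAt_dirDeriv (hG x hx) _)))).of_le
        (by simp)
  have hW_compact : ∀ i, HasCompactSupport (W i) := fun i => hφ_compact.mul_right
  -- Of the three product-rule terms, `φ G ΔG` vanishes by harmonicity, and `G ∇φ·∇G` because `∇φ`
  -- is radial.
  have hdiv : ∀ x, ∑ i, dirDeriv (b i) (W i) x = φ x * ∑ i, dirDeriv (b i) G x ^ 2 := by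
    intro x
    by_cases hx : x = 0
    · subst hx
      rw [hφ_zero.eq_of_nhds]
      simp only [Pi.zero_apply, zero_mul]
      refine Finset.sum_eq_zero fun i _ => ?_
      rw [dirDeriv, (hW_zero i).fderiv_eq]
      simp
    · have hd : DifferentiableAt ℝ G x := (hG x hx).differentiableAt (by simp)
      have hdi : ∀ i, DifferentiableAt ℝ (dirDeriv (b i) G) x := fun i =>
        (contDiffAt_dirDeriv (hG x hx) _).differentiableAt (by simp)
      have hrad' : ∑ i, ⟪x, b i⟫ * dirDeriv (b i) G x = 0 := by
        have h := congrArg (fderiv ℝ G x) (b.sum_repr' x)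
        rw [hrad x hx, map_sum] at h
        rw [← h]
        refine Finset.sum_congr rfl fun i _ => ?_
        rw [map_smul, real_inner_comm, smul_eq_mul, dirDeriv]
      have hterm : ∀ i, dirDeriv (b i) (W i) x = φ x * dirDeriv (b i) G x ^ 2 +
          φ x * G x * dirDeriv (b i) (dirDeriv (b i) G) x +
          2 * deriv β (‖x‖ ^ 2) * G x * (⟪x, b i⟫ * dirDeriv (b i) G x) := fun i => by
        rw [dirDeriv_mul (hφ.differentiable (by simp) x) (hd.fun_mul (hdi i)),
          dirDeriv_mul hd (hdi i), hφ_deriv]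
        ring
      simp_rw [hterm]
      rw [Finset.sum_add_distrib, Finset.sum_add_distrib, ← Finset.mul_sum, ← Finset.mul_sum,
        ← Finset.mul_sum, hrad', hharm x hx]
      ring
  have hint : ∫ x, φ x * ∑ i, dirDeriv (b i) G x ^ 2 = 0 := by
    simp_rw [← hdiv]
    rw [integral_finsetSum _ fun i _ => ?_]
    · exact Finset.sum_eq_zero fun i _ => integral_dirDeriv_eq_zero (hW i) (hW_compact i) _
    · exact (((hW i).continuous_fderiv one_ne_zero).clm_apply
        continuous_const).integrable_of_hasCompactSupport ((hW_compact i).fderiv_apply (𝕜 := ℝ) _)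
  have hcont : Continuous fun x => φ x * ∑ i, dirDeriv (b i) G x ^ 2 := by
    simp_rw [← hdiv]
    exact continuous_finsetSum _ fun i _ =>
      ((hW i).continuous_fderiv one_ne_zero).clm_apply continuous_const
  have hsum : ∑ i, dirDeriv (b i) G x₀ ^ 2 = 0 := by
    by_contra hne
    have h1 : φ x₀ = 1 := β.one_of_mem_closedBall (Metric.mem_closedBall_self (by positivity))
    have hpos : 0 < ∫ x, φ x * ∑ i, dirDeriv (b i) G x ^ 2 :=
      hcont.integral_pos_of_hasCompactSupport_nonneg_nonzero hφ_compact.mul_right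
        (fun x => mul_nonneg β.nonneg (Finset.sum_nonneg fun i _ => sq_nonneg _))
        (x := x₀) (by rw [h1, one_mul]; exact hne)
    exact hpos.ne' hint
  have hzero := (Finset.sum_eq_zero_iff_of_nonneg fun i _ => sq_nonneg _).1 hsum
  ext v
  rw [← b.sum_repr' v, map_sum]
  refine Finset.sum_eq_zero fun i hi => ?_
  have : fderiv ℝ G x₀ (b i) = 0 := pow_eq_zero_iff two_ne_zero |>.1 (hzero i hi)
  rw [map_smul, this, smul_zero]

/-- A function on the punctured space that is homogeneous of degree one and harmonic is linear. -/
theorem exists_eq_inner_of_homogeneous_harmonic (hE : 1 < finrank ℝ E)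
    (b : OrthonormalBasis ι ℝ E) {F : E → ℝ}
    (hF : ∀ x ≠ 0, ContDiffAt ℝ ∞ F x) (hhom : ∀ t : ℝ, 0 < t → ∀ x, F (t • x) = t * F x)
    (hharm : ∀ x ≠ 0, ∑ i, dirDeriv (b i) (dirDeriv (b i) F) x = 0) :
    ∃ p : E, ∀ x ≠ 0, F x = ⟪x, p⟫ := by
  have hnhds : ∀ x : E, x ≠ 0 → ∀ᶠ y in nhds x, y ≠ 0 := fun x hx => isOpen_ne.mem_nhds hx
  -- Derivatives of `F` are homogeneous of degree zero, and harmonic because partial derivatives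
  -- commute.
  have hG : ∀ v, ∀ x ≠ 0, fderiv ℝ (dirDeriv v F) x = 0 := fun v x hx => by
    refine fderiv_eq_zero_of_harmonic b (fun x hx => contDiffAt_dirDeriv (hF x hx) v)
      (fun x hx => ?_) (fun x hx => ?_) hx
    · refine fderiv_self_of_homogeneous_zero (fun t ht y => ?_)
        ((contDiffAt_dirDeriv (hF x hx) v).differentiableAt (by simp))
      rw [dirDeriv, fderiv_smul_eq_of_homogeneous_one hhom t ht, dirDeriv]
    · have h1 : ∀ i, dirDeriv (b i) (dirDeriv (b i) (dirDeriv v F)) x =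
          dirDeriv v (dirDeriv (b i) (dirDeriv (b i) F)) x := fun i => by
        have : dirDeriv (b i) (dirDeriv v F) =ᶠ[nhds x] dirDeriv v (dirDeriv (b i) F) := by
          filter_upwards [hnhds x hx] with y hy using dirDeriv_comm (hF y hy) _ _
        rw [dirDeriv_congr this, dirDeriv_comm (contDiffAt_dirDeriv (hF x hx) _)]
      have h2 : dirDeriv v (fun y => ∑ i, dirDeriv (b i) (dirDeriv (b i) F) y) x =
          ∑ i, dirDeriv v (dirDeriv (b i) (dirDeriv (b i) F)) x := by
        rw [dirDeriv, fderiv_fun_sum fun i _ => (contDiffAt_dirDeriv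
          (contDiffAt_dirDeriv (hF x hx) _) _).differentiableAt (by simp)]
        simp [dirDeriv]
      simp_rw [h1]
      rw [← h2]
      have h3 : (fun y => ∑ i, dirDeriv (b i) (dirDeriv (b i) F) y) =ᶠ[nhds x] fun _ => 0 := by
        filter_upwards [hnhds x hx] with y hy using hharm y hy
      rw [dirDeriv_congr h3, dirDeriv]
      simp
  have hd : ∀ x ≠ 0, DifferentiableAt ℝ (fderiv ℝ F) x := fun x hx =>
    ((hF x hx).fderiv_right (m := ∞) (by simp)).differentiableAt (by simp)
  -- Connectedness needs dimension at least two; on the line, `|x|` is a counterexample.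
  obtain ⟨L, hL⟩ : ∃ L, ∀ x ∈ ({0}ᶜ : Set E), fderiv ℝ F x = L := by
    refine isOpen_compl_singleton.exists_is_const_of_fderiv_eq_zero
      (isConnected_compl_singleton_of_one_lt_rank ?_ 0).isPreconnected
      (fun x hx => (hd x hx).differentiableWithinAt) fun x hx => ?_
    · rw [← finrank_eq_rank]
      exact_mod_cast hE
    · ext w v
      rw [← dirDeriv_dirDeriv (hF x hx), dirDeriv, hG v x hx]
      rfl
  refine ⟨(InnerProductSpace.toDual ℝ E).symm L, fun x hx => ?_⟩
  rw [real_inner_comm, InnerProductSpace.toDual_symm_apply, ← hL x hx,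
    fderiv_self_of_homogeneous_one hhom ((hF x hx).differentiableAt (by simp))]

end Divergence

end OrientedLines

namespace OrientedLines

/-! ### The spherical Laplacian and its eigenfunctions -/

section Laplacian

variable {n : ℕ}

/-- By Euler's identity the normal component of `∇F` is `F u`. The right side makes sense off the
sphere, so `nabla` can be computed by an ambient derivative. -/
theorem ambient_grad_of_homogeneous {F : Euc n → ℝ} (hF : ∀ x ≠ 0, ContDiffAt ℝ ∞ F x)
    (hhom : ∀ t : ℝ, 0 < t → ∀ x, F (t • x) = t * F x) (u : Sph n) :
    ambient u (grad (fun w : Sph n => F w) u) = gradient F u - F u • (u : Euc n) := by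
  have hd := (hF u (sph_ne_zero u)).differentiableAt (by simp)
  rw [grad_comp_coe hd, ambient_tangential, inner_gradient_left,
    fderiv_self_of_homogeneous_one hhom hd]

/-- The spherical Laplacian of the restriction of a function homogeneous of degree one. -/
theorem laplaceSph_of_homogeneous {ι : Type*} [Fintype ι] (b : OrthonormalBasis ι ℝ (Euc n))
    {F : Euc n → ℝ} (hF : ∀ x ≠ 0, ContDiffAt ℝ ∞ F x)
    (hhom : ∀ t : ℝ, 0 < t → ∀ x, F (t • x) = t * F x) (u : Sph n) :
    laplaceSph (fun w : Sph n => F w) u =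
      n * F u - ∑ i, dirDeriv (b i) (dirDeriv (b i) F) (u : Euc n) := by
  have hu := sph_ne_zero u
  have hd : DifferentiableAt ℝ F (u : Euc n) := (hF u hu).differentiableAt (by simp)
  have hD : DifferentiableAt ℝ (fderiv ℝ F) (u : Euc n) :=
    ((hF u hu).fderiv_right (m := ∞) (by simp)).differentiableAt (by simp)
  let J : (Euc n →L[ℝ] ℝ) →L[ℝ] Euc n :=
    (InnerProductSpace.toDual ℝ (Euc n)).symm.toContinuousLinearEquiv.toContinuousLinearMap
  have hgrad : HasFDerivAt (gradient F) (J ∘L fderiv ℝ (fderiv ℝ F) u) (u : Euc n) :=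
    J.hasFDerivAt.comp (u : Euc n) hD.hasFDerivAt
  let A : Euc n →L[ℝ] Euc n := J ∘L fderiv ℝ (fderiv ℝ F) u
  -- `A` is the Hessian; as `dF` has degree zero, it kills the radial direction.
  have hA_self : A (u : Euc n) = 0 := by
    have : fderiv ℝ (fderiv ℝ F) (u : Euc n) u = 0 :=
      fderiv_self_of_homogeneous_zero (fderiv_smul_eq_of_homogeneous_one hhom) hD
    simp [A, this]
  -- The summand of this derivative that differentiates the factor `F` is a multiple of `u`, so
  -- `tangential` removes it.
  have hK := hgrad.sub (hd.hasFDerivAt.smul (hasFDerivAt_id (u : Euc n)))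
  have hnabla : nabla (grad fun w : Sph n => F w) u =
      tangential u ∘ₗ (A.toLinearMap ∘ₗ (ambient u).toLinearMap) - F u • LinearMap.id := by
    ext X : 1
    have hfun : (fun w : Sph n => ambient w (grad (fun w : Sph n => F w) w)) =
        fun w : Sph n => (gradient F - F • (id : Euc n → Euc n)) (w : Euc n) :=
      funext fun w => ambient_grad_of_homogeneous hF hhom w
    rw [nabla, hfun, LinearMap.comp_apply]
    change tangential u (mvfderiv (𝓡 n) _ u X) = _
    rw [mvfderiv_comp_coe hK.differentiableAt, hK.fderiv]
    simp [tangential_ambient, tangential_self, A]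
  -- With cyclicity of the trace, this turns the trace over the tangent space into the full trace of
  -- `A`, which is `ΔF`.
  have hcomp : A.toLinearMap ∘ₗ ((ambient u).toLinearMap ∘ₗ tangential u) = A.toLinearMap := by
    ext v : 1
    change A (ambient u (tangential u v)) = A v
    rw [ambient_tangential, map_sub, map_smul, hA_self, smul_zero, sub_zero]
  have hrank : finrank ℝ (TSph n u) = n := finrank_euclideanSpace_fin
  rw [laplaceSph, divergence, hnabla, map_sub, map_smul, LinearMap.trace_id, hrank,
    LinearMap.trace_comp_comm', LinearMap.comp_assoc, hcomp, LinearMap.trace_eq_sum_inner _ b]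
  have hterm : ∀ i, ⟪b i, A.toLinearMap (b i)⟫ =
      dirDeriv (b i) (dirDeriv (b i) F) (u : Euc n) := fun i => by
    rw [dirDeriv_dirDeriv (hF u hu), real_inner_comm]
    exact InnerProductSpace.toDual_symm_apply
  simp_rw [hterm]
  rw [smul_eq_mul]
  ring

/-- The extension of a function on the sphere that is homogeneous of degree one. -/
noncomputable def homogeneousExtension (f : Sph n → ℝ) (x : Euc n) : ℝ :=
  -- The default `0` is reached only at `x = 0`, where the factor `‖x‖` vanishes anyway.
  ‖x‖ * Function.extend (fun u : Sph n => (u : Euc n)) f 0 (‖x‖⁻¹ • x)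

theorem homogeneousExtension_coe (f : Sph n → ℝ) (u : Sph n) :
    homogeneousExtension f u = f u := by
  rw [homogeneousExtension, norm_coe_sph, inv_one, one_smul, one_mul,
    Subtype.val_injective.extend_apply]

theorem homogeneousExtension_smul (f : Sph n → ℝ) (t : ℝ) (ht : 0 < t) (x : Euc n) :
    homogeneousExtension f (t • x) = t * homogeneousExtension f x := by
  rw [homogeneousExtension, homogeneousExtension, norm_smul, Real.norm_of_nonneg ht.le, smul_smul,
    mul_inv_rev, mul_assoc ‖x‖⁻¹, inv_mul_cancel₀ ht.ne', mul_one, mul_assoc]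

theorem contDiffAt_homogeneousExtension {f : Sph n → ℝ} (hf : ContMDiff (𝓡 n) 𝓘(ℝ, ℝ) ∞ f)
    {x : Euc n} (hx : x ≠ 0) : ContDiffAt ℝ ∞ (homogeneousExtension f) x := by
  refine (contDiffAt_norm ℝ hx).mul ?_
  rw [← contMDiffAt_iff_contDiffAt]
  -- Radial projection lands in the sphere only off the origin, so it is treated as a map on this
  -- open submanifold.
  let U : TopologicalSpace.Opens (Euc n) := ⟨{0}ᶜ, isOpen_compl_singleton⟩
  have hsmooth : ContMDiff 𝓘(ℝ, Euc n) 𝓘(ℝ, Euc n) ∞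
      (fun y : U => ‖(y : Euc n)‖⁻¹ • (y : Euc n)) := fun y => by
    have hy : (y : Euc n) ≠ 0 := y.2
    refine contMDiffAt_subtype_iff (f := fun y : Euc n => ‖y‖⁻¹ • y).2 ?_
    exact (((contDiffAt_norm ℝ hy).inv (norm_ne_zero_iff.2 hy)).smul contDiffAt_id).contMDiffAt
  have hmem : ∀ y : U, ‖(y : Euc n)‖⁻¹ • (y : Euc n) ∈ sphere (0 : Euc n) 1 := fun y => by
    have hy : (y : Euc n) ≠ 0 := y.2
    rw [mem_sphere_zero_iff_norm, norm_smul, norm_inv, norm_norm,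
      inv_mul_cancel₀ (norm_ne_zero_iff.2 hy)]
  refine (contMDiffAt_subtype_iff (U := U) (x := ⟨x, hx⟩)).1 ?_
  have heq : (fun y : U => Function.extend (fun u : Sph n => (u : Euc n)) f 0
      (‖(y : Euc n)‖⁻¹ • (y : Euc n))) = f ∘ Set.codRestrict _ _ hmem :=
    funext fun y => Subtype.val_injective.extend_apply f 0 (Set.codRestrict _ _ hmem y)
  rw [heq]
  exact (hf.comp (hsmooth.codRestrict_sphere hmem)) _

theorem exists_eq_inner_of_isEigenfunction (hn : 1 ≤ n) {f : Sph n → ℝ}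
    (hf : IsEigenfunction (n : ℝ) f) : ∃ p : Euc n, ∀ u : Sph n, f u = ⟪(u : Euc n), p⟫ := by
  let F := homogeneousExtension f
  let b := EuclideanSpace.basisFun (Fin (n + 1)) ℝ
  have hF : ∀ x ≠ 0, ContDiffAt ℝ ∞ F x := fun x hx => contDiffAt_homogeneousExtension hf.1 hx
  have hhom : ∀ t : ℝ, 0 < t → ∀ x, F (t • x) = t * F x := homogeneousExtension_smul f
  have hfF : f = fun w : Sph n => F w := funext fun w => (homogeneousExtension_coe f w).symm
  have hsph : ∀ u : Sph n, ∑ i, dirDeriv (b i) (dirDeriv (b i) F) (u : Euc n) = 0 := fun u => by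
    have h1 := laplaceSph_of_homogeneous b hF hhom u
    have h2 := hf.2 u
    rw [← hfF, h2] at h1
    have h3 : F u = f u := homogeneousExtension_coe f u
    rw [h3] at h1
    linarith
  have hharm : ∀ x ≠ 0, ∑ i, dirDeriv (b i) (dirDeriv (b i) F) x = 0 := fun x hx => by
    have hxn : ‖x‖ ≠ 0 := norm_ne_zero_iff.2 hx
    let u : Sph n := ⟨‖x‖⁻¹ • x, by
      rw [mem_sphere_zero_iff_norm, norm_smul, norm_inv, norm_norm, inv_mul_cancel₀ hxn]⟩
    have hxu : x = ‖x‖ • (u : Euc n) := by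
      change x = ‖x‖ • ‖x‖⁻¹ • x
      rw [smul_smul, mul_inv_cancel₀ hxn, one_smul]
    -- The Hessian has degree `-1`, so harmonicity spreads from the sphere to all `x ≠ 0`.
    have hscale : ‖x‖ • fderiv ℝ (fderiv ℝ F) x = (1 : ℝ) • fderiv ℝ (fderiv ℝ F) (u : Euc n) := by
      have h := fderiv_smul_of_homogeneous (f := fderiv ℝ F) (t := ‖x‖) (c := 1) (fun y => by
        rw [fderiv_smul_eq_of_homogeneous_one hhom _ (norm_pos_iff.2 hx), one_smul]) (u : Euc n)
      rwa [← hxu] at h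
    refine (mul_eq_zero.1 ?_).resolve_left hxn
    rw [← hsph u, Finset.mul_sum]
    refine Finset.sum_congr rfl fun i _ => ?_
    rw [dirDeriv_dirDeriv (hF x hx), dirDeriv_dirDeriv (hF u (sph_ne_zero u))]
    simpa using congrArg (fun T => T (b i) (b i)) hscale
  obtain ⟨p, hp⟩ := exists_eq_inner_of_homogeneous_harmonic (F := F)
    (by rw [finrank_euclideanSpace_fin]; omega) b hF hhom hharm
  exact ⟨p, fun u => by rw [← hp u (sph_ne_zero u), ← homogeneousExtension_coe f u]⟩

theorem gradient_inner_right (p x : Euc n) : gradient (fun y : Euc n => ⟪y, p⟫) x = p := by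
  refine ext_inner_right ℝ fun v => ?_
  rw [inner_gradient_left, show (fun y : Euc n => ⟪y, p⟫) = innerSL ℝ p from
    funext fun y => real_inner_comm p y, ContinuousLinearMap.fderiv, innerSL_apply_apply]

theorem grad_inner (p : Euc n) :
    grad (fun u : Sph n => ⟪(u : Euc n), p⟫) = pointSection p := by
  funext u
  rw [grad_comp_coe (F := fun y : Euc n => ⟪y, p⟫)
    (differentiableAt_id.inner ℝ (differentiableAt_const p)), gradient_inner_right]
  rfl

theorem isEigenfunction_inner (p : Euc n) :
    IsEigenfunction (n : ℝ) (fun u : Sph n => ⟪(u : Euc n), p⟫) := by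
  have hsmooth : ContDiff ℝ ∞ fun y : Euc n => ⟪y, p⟫ := contDiff_id.inner ℝ contDiff_const
  refine ⟨hsmooth.contMDiff.comp contMDiff_coe_sphere, fun u => ?_⟩
  have hzero : ∀ v : Euc n, ∀ x, dirDeriv v (dirDeriv v fun y : Euc n => ⟪y, p⟫) x = 0 := by
    intro v x
    have : (dirDeriv v fun y : Euc n => ⟪y, p⟫) = fun _ => ⟪p, v⟫ := funext fun y => by
      rw [dirDeriv, ← inner_gradient_left, gradient_inner_right]
    rw [this, dirDeriv]
    simp
  rw [laplaceSph_of_homogeneous (F := fun y : Euc n => ⟪y, p⟫)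
    (EuclideanSpace.basisFun (Fin (n + 1)) ℝ) (fun x _ => hsmooth.contDiffAt)
    (fun t _ x => real_inner_smul_left x p t) u]
  simp [hzero]

theorem eq_of_forall_inner_sph_eq {p q : Euc n}
    (h : ∀ u : Sph n, ⟪(u : Euc n), p⟫ = ⟪(u : Euc n), q⟫) : p = q := by
  ext i
  simpa [EuclideanSpace.inner_single_left] using h ⟨EuclideanSpace.single i 1, by simp⟩

end Laplacian

/-! ### Oriented lines and the sections `L_p` -/

section Lines

variable {n : ℕ}

theorem mem_toOrientedLine_iff (p : Euc n) (z : TangentBundle (𝓡 n) (Sph n)) :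
    p ∈ (toOrientedLine z).line ↔ z.2 = pointSection p z.1 := by
  rw [eq_comm, pointSection, tangential_eq_iff]
  exact AffineSubspace.mem_mk'

/-- The tangent vector is recovered as the tangential part of any point of the line. -/
theorem toOrientedLine_bijective :
    Function.Bijective (toOrientedLine : TangentBundle (𝓡 n) (Sph n) → OrientedLine n) := by
  constructor
  · rintro ⟨u, X⟩ ⟨w, Y⟩ h
    obtain rfl : u = w := congrArg OrientedLine.dir h
    have hmem : ambient u X ∈ (toOrientedLine ⟨u, Y⟩).line := by
      rw [← h]
      exact AffineSubspace.self_mem_mk' _ _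
    have hY : Y = tangential u (ambient u X) := (mem_toOrientedLine_iff _ _).1 hmem
    rw [hY, tangential_ambient]
  · intro l
    obtain ⟨q, hq⟩ := l.nonempty
    refine ⟨⟨l.dir, tangential l.dir q⟩, OrientedLine.ext ?_ rfl⟩
    have hmem : q ∈ (toOrientedLine ⟨l.dir, tangential l.dir q⟩).line :=
      (mem_toOrientedLine_iff _ _).2 rfl
    refine AffineSubspace.ext_of_direction_eq ?_ ⟨q, hmem, hq⟩
    rw [(toOrientedLine _).direction_eq, l.direction_eq]
    rfl

/-- Pythagoras: `v` is orthogonal to `u`. -/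
theorem norm_ambient_lt {z : TangentBundle (𝓡 n) (Sph n)} {x : Euc n}
    (hx : x ∈ (toOrientedLine z).line) (hne : x ≠ ambient z.1 z.2) :
    ‖ambient z.1 z.2‖ < ‖x‖ := by
  obtain ⟨c, hc⟩ := Submodule.mem_span_singleton.1 (AffineSubspace.mem_mk'.1 hx)
  have hxc : x = ambient z.1 z.2 + c • (z.1 : Euc n) := by
    rw [hc, vsub_eq_sub, add_sub_cancel]
  have hc0 : c ≠ 0 := by
    rintro rfl
    exact hne (by rw [hxc, zero_smul, add_zero])
  have h : ‖x‖ ^ 2 = ‖ambient z.1 z.2‖ ^ 2 + c ^ 2 := by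
    rw [hxc, norm_add_sq_real, inner_smul_right, inner_ambient, norm_smul, norm_coe_sph]
    simp
  refine lt_of_pow_lt_pow_left₀ 2 (norm_nonneg _) ?_
  rw [h]
  exact lt_add_of_pos_right _ (by positivity)

theorem pointSection_injective (hn : 1 ≤ n) :
    Function.Injective (pointSection : Euc n → (u : Sph n) → TSph n u) := by
  intro p q h
  have hzero : ∀ u : Sph n, p - q = ⟪p - q, (u : Euc n)⟫ • (u : Euc n) := fun u => by
    have := ambient_tangential u (p - q)
    rw [map_sub, show tangential u p = tangential u q from congrFun h u, sub_self, map_zero] at this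
    exact (sub_eq_zero.1 this.symm)
  obtain ⟨m, rfl⟩ : ∃ m, n = m + 1 := ⟨n - 1, by omega⟩
  let e : Fin (m + 2) → Sph (m + 1) := fun i => ⟨EuclideanSpace.single i 1, by simp⟩
  refine sub_eq_zero.1 ?_
  ext i
  -- `p - q` is a multiple of `e j`, so its coordinate `i` vanishes. A second index exists because
  -- `1 ≤ n`; for `n = 0` every `L_p` is zero.
  obtain ⟨j, hj⟩ := exists_ne i
  have := congrArg (fun v : Euc (m + 1) => v i) (hzero (e j))
  simpa [e, hj, hj.symm] using this

end Lines

end OrientedLines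

theorem theorem1 (n : ℕ) (hn : 1 ≤ n) :
    -- points of `TSⁿ` correspond to oriented lines
    Function.Bijective
      (OrientedLines.toOrientedLine :
        TangentBundle (𝓡 n) (OrientedLines.Sph n) → OrientedLines.OrientedLine n) ∧
    -- under this correspondence `(u, v)` is the line with direction `u` whose point nearest to
    -- the origin is `v`
    (∀ z : TangentBundle (𝓡 n) (OrientedLines.Sph n),
      (OrientedLines.toOrientedLine z).dir = z.1 ∧
      OrientedLines.ambient z.1 z.2 ∈ (OrientedLines.toOrientedLine z).line ∧
      ∀ x ∈ (OrientedLines.toOrientedLine z).line,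
        x ≠ OrientedLines.ambient z.1 z.2 → ‖OrientedLines.ambient z.1 z.2‖ < ‖x‖) ∧
    -- `p ↦ L_p` is a bijection from the points of `ℝⁿ⁺¹` onto the Laplace sections
    Set.BijOn
      (OrientedLines.pointSection :
        OrientedLines.Euc n → (u : OrientedLines.Sph n) → OrientedLines.TSph n u)
      Set.univ {s | OrientedLines.IsLaplaceSection s} ∧
    -- `L_p` consists of the points of `TSⁿ` whose oriented lines pass through `p`
    (∀ (p : OrientedLines.Euc n) (z : TangentBundle (𝓡 n) (OrientedLines.Sph n)),
      p ∈ (OrientedLines.toOrientedLine z).line ↔ z.2 = OrientedLines.pointSection p z.1) ∧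
    -- `L_p` is given by `u ↦ p - (p · u) u`
    (∀ (p : OrientedLines.Euc n) (u : OrientedLines.Sph n),
      OrientedLines.ambient u (OrientedLines.pointSection p u) =
        p - ⟪p, (u : OrientedLines.Euc n)⟫ • (u : OrientedLines.Euc n)) ∧
    -- the functions `u ↦ u · p` are eigenfunctions with eigenvalue `n`, with gradient `L_p`
    (∀ p : OrientedLines.Euc n,
      OrientedLines.IsEigenfunction (n : ℝ)
        (fun u : OrientedLines.Sph n => ⟪(u : OrientedLines.Euc n), p⟫) ∧
      OrientedLines.grad (fun u : OrientedLines.Sph n => ⟪(u : OrientedLines.Euc n), p⟫) =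
        OrientedLines.pointSection p) ∧
    -- and there are no other eigenfunctions with eigenvalue `n`
    (∀ f : OrientedLines.Sph n → ℝ, OrientedLines.IsEigenfunction (n : ℝ) f →
      ∃! p : OrientedLines.Euc n, ∀ u : OrientedLines.Sph n,
        f u = ⟪(u : OrientedLines.Euc n), p⟫) := by
  refine ⟨OrientedLines.toOrientedLine_bijective,
    fun z => ⟨rfl, AffineSubspace.self_mem_mk' _ _, fun x => OrientedLines.norm_ambient_lt⟩,
    ⟨fun p _ => ⟨_, OrientedLines.isEigenfunction_inner p, (OrientedLines.grad_inner p).symm⟩,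
      (OrientedLines.pointSection_injective hn).injOn, ?_⟩,
    OrientedLines.mem_toOrientedLine_iff, fun p u => OrientedLines.ambient_tangential u p,
    fun p => ⟨OrientedLines.isEigenfunction_inner p, OrientedLines.grad_inner p⟩, fun f hf => ?_⟩
  · rintro s ⟨f, hf, rfl⟩
    obtain ⟨p, hp⟩ := OrientedLines.exists_eq_inner_of_isEigenfunction hn hf
    exact ⟨p, trivial, by rw [show f = _ from funext hp, OrientedLines.grad_inner]⟩
  · obtain ⟨p, hp⟩ := OrientedLines.exists_eq_inner_of_isEigenfunction hn hf
    exact ⟨p, hp, fun q hq =>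
      OrientedLines.eq_of_forall_inner_sph_eq fun u => by rw [← hq u, hp u]⟩
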